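/- Let $k$ be a field of characteristic zero, $\Gamma$ an abelian group and $\epsilon:\Gamma\times\Gamma\to k^{\ast}$ a commutation factor, i.e. $\epsilon(\alpha,\beta)\epsilon(\beta,\alpha)=1$, $\epsilon(\alpha,\beta+\gamma)=\epsilon(\alpha,\beta)\epsilon(\alpha,\gamma)$ and $\epsilon(\alpha+\beta,\gamma)=\epsilon(\alpha,\gamma)\epsilon(\beta,\gamma)$. Let $S=\bigoplus_{\gamma\in\Gamma}S_\gamma$ be a finite-dimensional generalized left-symmetric algebra: a $\Gamma$-graded nonassociative $k$-algebra with $S_\alpha\cdot S_\beta\subseteq S_{\alpha+\beta}$ and $$(x\cdot y)\cdot z-x\cdot(y\cdot z)=\epsilon(\alpha,\beta)\big((y\cdot x)\cdot z-y\cdot(x\cdot z)\big)\qquad(x\in S_\alpha,\ y\in S_\beta,\ z\in S).$$ Let $M=\bigoplus_{\gamma\in\Gamma}M_\gamma$ be a finite-dimensional $S$-bimodule: a graded space with bilinear left and right actions of $S$ satisfying $S_\alpha\cdot M_\gamma\subseteq M_{\alpha+\gamma}$, $M_\gamma\cdot S_\alpha\subseteq M_{\gamma+\alpha}$ and, for $x\in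 S_\alpha$, $y\in S_\beta$, $m\in M_\gamma$, $$(x\cdot y)\cdot m-x\cdot(y\cdot m)=\epsilon(\alpha,\beta)\big((y\cdot x)\cdot m-y\cdot(x\cdot m)\big),$$ $$(x\cdot m)\cdot y-x\cdot(m\cdot y)=\epsilon(\alpha,\gamma)\big((m\cdot x)\cdot y-m\cdot(x\cdot y)\big).$$ Put $[x,y]=x\cdot y-\epsilon(\alpha,\beta)\,y\cdot x$ for $x\in S_\alpha$, $y\in S_\beta$. Let $\wedge^n_\epsilon S$ be the quotient of $S^{\otimes n}$ by the degree-$n$ part of the two-sided ideal of the tensor algebra generated by all $x\otimes y+\epsilon(\alpha,\beta)\,y\otimes x$ with $x\in S_\alpha$, $y\in S_\beta$. For $i\ge1$ let $T^i=\mathrm{Hom}(S^{\otimes (i-1)}\otimes S,M)$ and $C^i(S,M)=\mathrm{Hom}(\wedge^{i-1}_\epsilon S\otimes S,M)$, which is regarded as a subspace of $T^i$, and let $C^0(S,M)=\{m\in M\mid (ab)m=a(bm)\text{ for all }a,b\in S\}$. A map $f\in T^i$ is homogeneous of degree $\beta$ if $f(x_1,\dots,x_i)\in M_{\beta+\alpha_1+\cdots+\alpha_i}$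 whenever $x_s\in S_{\alpha_s}$. For $t\ge1$ let $D_t:T^i\to T^{i+1}$ be the linear map with $D_t=0$ for $t>i$ and, for $t\le i$, $f$ homogeneous of degree $\beta$ and $x_s\in S_{\alpha_s}$, $$\begin{aligned}(D_tf)(x_1,\dots,x_{i+1})={}&\epsilon(\beta+\alpha_1+\cdots+\alpha_{t-1},\alpha_t)\,x_t\cdot f(x_1,\dots,\hat x_t,\dots,x_{i+1})\\&-\epsilon(\alpha_t,\alpha_{t+1}+\cdots+\alpha_i)\,f(x_1,\dots,\hat x_t,\dots,x_i,x_t\cdot x_{i+1})\\&+\epsilon(\alpha_t,\alpha_{t+1}+\cdots+\alpha_i)\,f(x_1,\dots,\hat x_t,\dots,x_i,x_t)\cdot x_{i+1}\\&-\sum_{t<j\le i}\epsilon(\alpha_t,\alpha_{t+1}+\cdots+\alpha_{j-1})\,f(x_1,\dots,\hat x_t,\dots,x_{j-1},[x_t,x_j],\dots,x_i,x_{i+1}).\end{aligned}$$ Then the following hold. (1) The operators $D_t$ are well defined and homogeneous of degree zero, and $D_tD_s=D_sD_{t-1}$ on $T^i$, in particular on $C^i(S,M)$, for all $1\le s<t$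 and $i\ge1$. (2) The operator $d=-\sum_t(-1)^tD_t$ satisfies $d^2=0$ on $\bigoplus_{i\ge1}T^i$. (3) The operator $d$ maps $C^i(S,M)$ to $C^{i+1}(S,M)$ for $i\ge1$. There is a unique linear map $d:C^0(S,M)\to C^1(S,M)$ with $(dm)(x)=\epsilon(\beta,\alpha)\,x\cdot m-m\cdot x$ for $m\in C^0(S,M)\cap M_\beta$ and $x\in S_\alpha$. With these maps, which are homogeneous of degree zero, $C^0(S,M)\to C^1(S,M)\to C^2(S,M)\to\cdots$ is a cochain complex, i.e. $d^2=0$. So the coboundaries $B^i(S,M)$ lie in the cocycles $Z^i(S,M)$, and the cohomology spaces $H^i(S,M)=Z^i(S,M)/B^i(S,M)$ are defined. -/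

import Mathlib

open scoped TensorProduct DirectSum

universe uΓ uk uS uM

/-- A commutation factor on the abelian group `Γ` with values in the units of the field `k`. -/
structure CommutationFactor (Γ : Type uΓ) (k : Type uk) [AddCommGroup Γ] [Field k] where
  val : Γ → Γ → kˣ
  val_mul_val_swap : ∀ α β, val α β * val β α = 1
  val_add_right : ∀ α β γ, val α (β + γ) = val α β * val α γ
  val_add_left : ∀ α β γ, val (α + β) γ = val α γ * val β γ

instance {Γ : Type uΓ} {k : Type uk} [AddCommGroup Γ] [Field k] :
    CoeFun (CommutationFactor Γ k) (fun _ => Γ → Γ → kˣ) := ⟨CommutationFactor.val⟩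

noncomputable section

section

variable {Γ : Type uΓ} {k : Type uk} [AddCommGroup Γ] [DecidableEq Γ] [Field k]
variable {S : Type uS} [AddCommGroup S] [Module k S]
variable {M : Type uM} [AddCommGroup M] [Module k M]

/-- A generalized left-symmetric algebra structure on the graded space `S = ⨁ γ, 𝒮 γ`. -/
structure GenLeftSymmAlgebra (ε : CommutationFactor Γ k) (𝒮 : Γ → Submodule k S)
    [DirectSum.Decomposition 𝒮] where
  mul : S →ₗ[k] S →ₗ[k] S
  mul_mem : ∀ {α β : Γ} {x y : S}, x ∈ 𝒮 α → y ∈ 𝒮 β → mul x y ∈ 𝒮 (α + β)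
  left_symm : ∀ {α β : Γ} {x y : S} (z : S), x ∈ 𝒮 α → y ∈ 𝒮 β →
    mul (mul x y) z - mul x (mul y z) = ε α β • (mul (mul y x) z - mul y (mul x z))

variable {ε : CommutationFactor Γ k}
variable {𝒮 : Γ → Submodule k S} [DirectSum.Decomposition 𝒮]
variable {ℳ : Γ → Submodule k M} [DirectSum.Decomposition ℳ]

/-- `A.bracket α β x y = x·y - ε(α, β) y·x`: on `x ∈ S_α`, `y ∈ S_β` this is the
`ε`-commutator `[x, y]`. -/
def GenLeftSymmAlgebra.bracket (A : GenLeftSymmAlgebra ε 𝒮) (α β : Γ) : S →ₗ[k] S →ₗ[k] S :=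
  A.mul - ε α β • A.mul.flip

/-- A bimodule structure on the graded space `M = ⨁ γ, ℳ γ` over a generalized left-symmetric
algebra; both actions are compatible with the gradations. -/
structure GenLeftSymmBimodule (A : GenLeftSymmAlgebra ε 𝒮) (ℳ : Γ → Submodule k M)
    [DirectSum.Decomposition ℳ] where
  left : S →ₗ[k] M →ₗ[k] M
  right : M →ₗ[k] S →ₗ[k] M
  left_mem : ∀ {α γ : Γ} {x : S} {m : M}, x ∈ 𝒮 α → m ∈ ℳ γ → left x m ∈ ℳ (α + γ)
  right_mem : ∀ {α γ : Γ} {x : S} {m : M}, m ∈ ℳ γ → x ∈ 𝒮 α → right m x ∈ ℳ (γ + α)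
  left_left : ∀ {α β : Γ} {x y : S} (m : M), x ∈ 𝒮 α → y ∈ 𝒮 β →
    left (A.mul x y) m - left x (left y m) = ε α β • (left (A.mul y x) m - left y (left x m))
  left_right : ∀ {α γ : Γ} {x : S} {m : M} (y : S), x ∈ 𝒮 α → m ∈ ℳ γ →
    right (left x m) y - left x (right m y) = ε α γ • (right (right m x) y - right m (A.mul x y))

/-! ### Tensor cochains -/

variable (k S M) in
/-- `TensorCochain k S M n` is `Hom(S^{⊗ n} ⊗ S, M)`: the maps `f(x₁, …, xₙ; y)` that are
linear in each of the `n + 1` arguments. -/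
abbrev TensorCochain (n : ℕ) : Type (max uS uM) :=
  MultilinearMap k (fun _ : Fin n => S) (S →ₗ[k] M)

variable (𝒮 ℳ) in
/-- The tensor cochains that are homogeneous of degree `β`. -/
def homogeneousTensorCochain (n : ℕ) (β : Γ) : Submodule k (TensorCochain k S M n) where
  carrier := {f | ∀ (α : Fin n → Γ) (δ : Γ) (v : Fin n → S) (y : S),
    (∀ s, v s ∈ 𝒮 (α s)) → y ∈ 𝒮 δ → f v y ∈ ℳ (β + ∑ s, α s + δ)}
  add_mem' hf hg α δ v y hv hy := (ℳ _).add_mem (hf α δ v y hv hy) (hg α δ v y hv hy)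
  zero_mem' _ _ _ _ _ _ := (ℳ _).zero_mem
  smul_mem' c _ hf α δ v y hv hy := (ℳ _).smul_mem c (hf α δ v y hv hy)

/-- The linear map that is multiplication by `ε(μ, α)` on the component of degree `μ`. -/
def degreeScale {V : Type*} [AddCommGroup V] [Module k V] (ε : CommutationFactor Γ k)
    (𝒱 : Γ → Submodule k V) [DirectSum.Decomposition 𝒱] (α : Γ) : V →ₗ[k] V :=
  (DirectSum.toModule k Γ V fun μ => ε μ α • (𝒱 μ).subtype) ∘ₗ
    (DirectSum.decomposeLinearEquiv 𝒱).toLinearMap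

variable (ε 𝒮 ℳ) in
/-- The linear map on tensor cochains that is multiplication by `ε(β, α)` on those of degree `β`:
`f` goes to `degreeScale α ∘ f ∘ (degreeScale (-α))^{⊗}`. -/
def cochainScale (n : ℕ) (α : Γ) : TensorCochain k S M n →ₗ[k] TensorCochain k S M n where
  toFun f :=
    ((degreeScale ε ℳ α).compRight k ∘ₗ
      (LinearMap.lcomp k M (degreeScale ε 𝒮 (-α)))).compMultilinearMap
        (f.compLinearMap fun _ => degreeScale ε 𝒮 (-α))
  map_add' _ _ := by ext; simp
  map_smul' _ _ := by ext; simp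

variable (𝒮) in
/-- The multilinear map that agrees with `F α` on homogeneous arguments of degrees
`α₁, …, αₙ`. -/
def extendHomogeneous {N : Type*} [AddCommGroup N] [Module k N] {n : ℕ} :
    ((Fin n → Γ) → MultilinearMap k (fun _ : Fin n => S) N) →ₗ[k]
      MultilinearMap k (fun _ : Fin n => S) N where
  toFun F :=
    (MultilinearMap.fromDirectSumEquiv (R := k) (κ := fun _ : Fin n => Γ)
      (M := fun _ γ => 𝒮 γ)
      (fun α => (F α).compLinearMap fun s => (𝒮 (α s)).subtype)).compLinearMap
        fun _ => (DirectSum.decomposeLinearEquiv 𝒮).toLinearMap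
  map_add' F G := by
    ext v
    have h : (fun α => ((F + G) α).compLinearMap fun s => (𝒮 (α s)).subtype) =
        (fun α => (F α).compLinearMap fun s => (𝒮 (α s)).subtype) +
          (fun α => (G α).compLinearMap fun s => (𝒮 (α s)).subtype) := rfl
    rw [h, map_add]; rfl
  map_smul' c F := by
    ext v
    have h : (fun α => ((c • F) α).compLinearMap fun s => (𝒮 (α s)).subtype) =
        c • (fun α => (F α).compLinearMap fun s => (𝒮 (α s)).subtype) := rfl
    rw [h, map_smul]; rfl

/-- `(v₁, …, vₙ₊₁) ↦ B(v_t, f(v₁, …, v̂_t, …, vₙ₊₁))`. -/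
def insertTerm {N : Type*} [AddCommGroup N] [Module k N] {n : ℕ} (t : Fin (n + 1))
    (B : S →ₗ[k] N →ₗ[k] N) :
    MultilinearMap k (fun _ : Fin n => S) N →ₗ[k]
      MultilinearMap k (fun _ : Fin (n + 1) => S) N where
  toFun f := MultilinearMap.mk' (fun v => B (v t) (f (t.removeNth v)))
    (by
      intro v i x y
      induction i using Fin.succAboveCases t with
      | x => simp
      | p i => simp [Fin.removeNth_update_succAbove])
    (by
      intro v i c x
      induction i using Fin.succAboveCases t with
      | x => simp
      | p i => simp [Fin.removeNth_update_succAbove])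
  map_add' _ _ := by ext; simp
  map_smul' _ _ := by ext; simp

/-- `(v₁, …, vₙ₊₁) ↦ f(v₁, …, v̂_t, …, b(v_t, v_j), …, vₙ₊₁)` with `b(v_t, v_j)` in place of
`v_j`, for `t < j`. -/
def bracketTerm {N : Type*} [AddCommGroup N] [Module k N] {n : ℕ} (b : S →ₗ[k] S →ₗ[k] S)
    (t : Fin (n + 1)) (j : {j : Fin (n + 1) // t < j}) :
    MultilinearMap k (fun _ : Fin n => S) N →ₗ[k]
      MultilinearMap k (fun _ : Fin (n + 1) => S) N where
  toFun f := MultilinearMap.mk'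
    (fun v => f (t.removeNth (Function.update v j.1 (b (v t) (v j.1)))))
    (by
      obtain ⟨j, hj⟩ := j
      obtain ⟨j, rfl⟩ := Fin.exists_succAbove_eq hj.ne'
      intro v i x y
      induction i using Fin.succAboveCases t with
      | x => simp [Fin.removeNth_update_succAbove]
      | p i =>
        rcases eq_or_ne i j with rfl | h
        · simp [Fin.removeNth_update_succAbove]
        · simp [Fin.removeNth_update_succAbove, Function.update_comm h, h.symm])
    (by
      obtain ⟨j, hj⟩ := j
      obtain ⟨j, rfl⟩ := Fin.exists_succAbove_eq hj.ne'
      intro v i c x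
      induction i using Fin.succAboveCases t with
      | x => simp [Fin.removeNth_update_succAbove]
      | p i =>
        rcases eq_or_ne i j with rfl | h
        · simp [Fin.removeNth_update_succAbove]
        · simp [Fin.removeNth_update_succAbove, Function.update_comm h, h.symm])
  map_add' _ _ := by ext; simp
  map_smul' _ _ := by ext; simp

namespace GenLeftSymmBimodule

variable {A : GenLeftSymmAlgebra ε 𝒮} (B : GenLeftSymmBimodule A ℳ)

/-- `(x, g) ↦ (y ↦ x · g(y))`. -/
def actValue : S →ₗ[k] (S →ₗ[k] M) →ₗ[k] (S →ₗ[k] M) :=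
  LinearMap.mk₂ k (fun x g => B.left x ∘ₗ g)
    (by intros; ext; simp) (by intros; ext; simp) (by intros; ext; simp) (by intros; ext; simp)

/-- `(x, g) ↦ (y ↦ g(x · y))`. -/
def actLast (_ : GenLeftSymmBimodule A ℳ) : S →ₗ[k] (S →ₗ[k] M) →ₗ[k] (S →ₗ[k] M) :=
  LinearMap.mk₂ k (fun x g => g ∘ₗ A.mul x)
    (by intros; ext; simp) (by intros; ext; simp) (by intros; ext; simp) (by intros; ext; simp)

/-- `(x, g) ↦ (y ↦ g(x) · y)`. -/
def actRight : S →ₗ[k] (S →ₗ[k] M) →ₗ[k] (S →ₗ[k] M) :=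
  LinearMap.mk₂ k (fun x g => B.right (g x))
    (by intros; ext; simp) (by intros; ext; simp) (by intros; ext; simp) (by intros; ext; simp)

/-- The operator `D_{t+1}` (positions are counted from `0` here). On arguments
`x₁, …, xₙ₊₁; y` with `x_s` of degree `α_s` and on `f` of degree `β` its first term is
`ε(β + α₁ + ⋯ + α_{t-1}, α_t) x_t · f(…, x̂_t, …; y)`; the factor `ε(β, α_t)` is produced by
`cochainScale`. -/
def face (n : ℕ) (t : Fin (n + 1)) : TensorCochain k S M n →ₗ[k] TensorCochain k S M (n + 1) :=
  extendHomogeneous 𝒮 ∘ₗ LinearMap.pi fun α : Fin (n + 1) → Γ =>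
    ε (∑ s ∈ Finset.Iio t, α s) (α t) • (insertTerm t B.actValue ∘ₗ cochainScale ε 𝒮 ℳ n (α t))
    - ε (α t) (∑ s ∈ Finset.Ioi t, α s) • insertTerm t B.actLast
    + ε (α t) (∑ s ∈ Finset.Ioi t, α s) • insertTerm t B.actRight
    - ∑ j : {j : Fin (n + 1) // t < j},
        ε (α t) (∑ s ∈ Finset.Ioo t j.1, α s) • bracketTerm (A.bracket (α t) (α j.1)) t j

/-- The operators `D_t`, `t = 1, 2, 3, …`, on `Hom(S^{⊗ n} ⊗ S, M)`, with `D_t = 0` for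
`t > n + 1`. -/
def D (t n : ℕ) : TensorCochain k S M n →ₗ[k] TensorCochain k S M (n + 1) :=
  if h : 1 ≤ t ∧ t ≤ n + 1 then B.face n ⟨t - 1, by omega⟩ else 0

/-- `d = - ∑_t (-1)^t D_t` on `Hom(S^{⊗ n} ⊗ S, M)`. -/
def tensorDiff (n : ℕ) : TensorCochain k S M n →ₗ[k] TensorCochain k S M (n + 1) :=
  -∑ t ∈ Finset.Icc 1 (n + 1), (-1 : k) ^ t • B.D t n

end GenLeftSymmBimodule

/-! ### The cochain spaces `C^i(S, M)` -/

variable (ε 𝒮) in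
/-- The degree-`n` part of the two-sided ideal of the tensor algebra of `S` generated by the
`x ⊗ y + ε(a, b) y ⊗ x` with `x ∈ S_a`, `y ∈ S_b`. -/
def extRelations (n : ℕ) : Submodule k (⨂[k] _ : Fin n, S) :=
  Submodule.span k {z | ∃ (p q : Fin n) (v : Fin n → S) (a b : Γ),
    (p : ℕ) + 1 = q ∧ v p ∈ 𝒮 a ∧ v q ∈ 𝒮 b ∧
    z = PiTensorProduct.tprod k v + ε a b • PiTensorProduct.tprod k (v ∘ Equiv.swap p q)}

variable (ε 𝒮) in
/-- The `n`-th `ε`-exterior power of `S`. -/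
abbrev ExtPower (n : ℕ) : Type (max uS uk) := (⨂[k] _ : Fin n, S) ⧸ extRelations ε 𝒮 n

variable (ε 𝒮) in
/-- The product `x₁ ∧ ⋯ ∧ xₙ` as a multilinear map. -/
def wedge (n : ℕ) : MultilinearMap k (fun _ : Fin n => S) (ExtPower ε 𝒮 n) :=
  (extRelations ε 𝒮 n).mkQ.compMultilinearMap (PiTensorProduct.tprod k)

variable (ε 𝒮 M) in
/-- `Cochain M ε 𝒮 n` is `C^{n+1}(S, M) = Hom(⋀^n S ⊗ S, M)`. -/
abbrev Cochain (n : ℕ) : Type (max uS uk uM) := (ExtPower ε 𝒮 n ⊗[k] S) →ₗ[k] M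

/-- The inclusion `Hom(⋀^n S ⊗ S, M) → Hom(S^{⊗ n} ⊗ S, M)`,
`f(x₁, …, xₙ; y) = f((x₁ ∧ ⋯ ∧ xₙ) ⊗ y)`. -/
def Cochain.toTensor {n : ℕ} : Cochain M ε 𝒮 n →ₗ[k] TensorCochain k S M n where
  toFun f := (TensorProduct.curry f).compMultilinearMap (wedge ε 𝒮 n)
  map_add' _ _ := by ext; simp
  map_smul' _ _ := by ext; simp

variable (ε 𝒮 ℳ) in
/-- The cochains in `C^{n+1}(S, M)` that are homogeneous of degree `β`. -/
def homogeneousCochain (n : ℕ) (β : Γ) : Submodule k (Cochain M ε 𝒮 n) :=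
  (homogeneousTensorCochain 𝒮 ℳ n β).comap Cochain.toTensor

namespace GenLeftSymmBimodule

variable {A : GenLeftSymmAlgebra ε 𝒮} (B : GenLeftSymmBimodule A ℳ)

/-- `C^0(S, M) = {m ∈ M | (ab)m = a(bm) for all a, b ∈ S}`. -/
def cochainZero : Submodule k M where
  carrier := {m | ∀ a b : S, B.left (A.mul a b) m = B.left a (B.left b m)}
  add_mem' hx hy a b := by simp only [map_add, hx a b, hy a b]
  zero_mem' a b := by simp
  smul_mem' c x hx a b := by simp only [map_smul, hx a b]

/-- `d₀ : C^0(S, M) → C^1(S, M)` satisfies `(d₀ m)(x) = ε(β, α) x·m - m·x` for `x ∈ S_α` and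
`m ∈ C^0(S, M) ∩ M_β`. -/
def IsCoboundaryZero (d₀ : B.cochainZero →ₗ[k] Cochain M ε 𝒮 0) : Prop :=
  ∀ (α β : Γ) (m : B.cochainZero) (x : S), (m : M) ∈ ℳ β → x ∈ 𝒮 α →
    (d₀ m).toTensor Fin.elim0 x = ε β α • B.left x m - B.right m x

/-- `d : C^{n+1}(S, M) → C^{n+2}(S, M)`, `n ≥ 0`, is the restriction of `-∑_t (-1)^t D_t`. -/
def IsCoboundarySucc (d : ∀ n, Cochain M ε 𝒮 n →ₗ[k] Cochain M ε 𝒮 (n + 1)) : Prop :=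
  ∀ (n : ℕ) (f : Cochain M ε 𝒮 n), (d n f).toTensor = B.tensorDiff n f.toTensor

end GenLeftSymmBimodule

end

end

set_option linter.unusedSectionVars false

noncomputable section

section

variable {Γ : Type uΓ} {k : Type uk} [AddCommGroup Γ] [DecidableEq Γ] [Field k]
variable {S : Type uS} [AddCommGroup S] [Module k S]
variable {M : Type uM} [AddCommGroup M] [Module k M]
variable {ε : CommutationFactor Γ k}
variable {𝒮 : Γ → Submodule k S} [DirectSum.Decomposition 𝒮]
variable {ℳ : Γ → Submodule k M} [DirectSum.Decomposition ℳ]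

/-! ### Commutation factors -/

namespace CommutationFactor

/-! The proof is Cartan calculus over the `ε`-Lie algebra S. Write ι_x for insertion of x as first
argument (`evalHead`) and L_x = ι_x D₁ (`lieAct`). A multilinear map is determined by its
contractions ι_x with homogeneous x, so identities between cochains are proved by induction on the
number of arguments.

Contraction lowers the index, ι_x D_{t+1} = D_t ι_x for t ≥ 1 (`evalHead_D`), and ι_y L_x = ε(a,b)
L_x ι_y - ι_[x,y] for x ∈ S_a, y ∈ S_b (`evalHead_lieAct`). On Hom(S, M) the bimodule axioms and
left symmetry give L_y L_x = ε(a,b) L_x L_y - L_[x,y] (`act_act`); the `ε`-Jacobi identity carries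
this relation to all tensor cochains (`lieAct_lieAct`). It says exactly that L_x commutes with D₁,
and contraction extends this to every D_t (`lieAct_D`). The identities D_t D_s = D_s D_{t-1} reduce
by contraction to s = 1, where they are this commutation.

For d the contraction rule reads ι_x d = L_x - d ι_x (`evalHead_tensorDiff_succ`). With L_x d = d
L_x it gives ι_x d² = d² ι_x, hence d² = 0 by induction, and it also shows that d preserves
`ε`-alternating cochains (`tensorDiff_mem_alt`), which are the cochains on the `ε`-exterior power
(`Cochain.range_toTensor`). In degree zero, d² = 0 is the mixed bimodule axiom together with the
condition defining C⁰. -/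

theorem val_zero_right (ε : CommutationFactor Γ k) (α : Γ) : ε α 0 = 1 := by
  simpa using ε.val_add_right α 0 0

theorem val_zero_left (ε : CommutationFactor Γ k) (α : Γ) : ε 0 α = 1 := by
  simpa using ε.val_add_left 0 0 α

/-- Both sides are inverse to ε(α, β). This is why scaling the arguments by `-α` in `cochainScale`
removes their contribution to the factor. -/
theorem val_neg_right (ε : CommutationFactor Γ k) (α β : Γ) : ε α (-β) = ε β α := by
  have h := ε.val_add_right α β (-β)
  rw [add_neg_cancel, val_zero_right] at h
  exact (mul_left_cancel (a := ε α β) (by rw [← h, ε.val_mul_val_swap]))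

end CommutationFactor

/-! ### Homogeneous extensionality and induction -/

theorem LinearMap.ext_homogeneous {V N : Type*} [AddCommGroup V] [Module k V] [AddCommGroup N]
    [Module k N] (𝒱 : Γ → Submodule k V) [DirectSum.Decomposition 𝒱] {f g : V →ₗ[k] N}
    (h : ∀ (a : Γ) (x : V), x ∈ 𝒱 a → f x = g x) : f = g := by
  ext x
  induction x using DirectSum.Decomposition.inductionOn 𝒱 with
  | zero => simp
  | homogeneous x => exact h _ _ x.2
  | add x y hx hy => simp [hx, hy]

theorem degreeScale_of_mem {V : Type*} [AddCommGroup V] [Module k V]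
    {𝒱 : Γ → Submodule k V} [DirectSum.Decomposition 𝒱] (α : Γ) {μ : Γ} {x : V}
    (hx : x ∈ 𝒱 μ) : degreeScale ε 𝒱 α x = ε μ α • x := by
  lift x to 𝒱 μ using hx
  simp [degreeScale, DirectSum.decomposeLinearEquiv, ← DirectSum.lof_eq_of k]

/-- Evaluation of a multilinear map at its first argument. -/
def evalHead {N : Type*} [AddCommGroup N] [Module k N] {n : ℕ} (x : S) :
    MultilinearMap k (fun _ : Fin (n + 1) => S) N →ₗ[k]
      MultilinearMap k (fun _ : Fin n => S) N where
  toFun f := f.curryLeft x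
  map_add' _ _ := rfl
  map_smul' _ _ := rfl

section evalHead

variable {N : Type*} [AddCommGroup N] [Module k N] {n : ℕ}

@[simp]
theorem evalHead_apply (x : S) (f : MultilinearMap k (fun _ : Fin (n + 1) => S) N)
    (v : Fin n → S) : evalHead x f v = f (Fin.cons x v) := rfl

theorem evalHead_add (x y : S) (f : MultilinearMap k (fun _ : Fin (n + 1) => S) N) :
    evalHead (x + y) f = evalHead x f + evalHead y f := f.curryLeft.map_add x y

theorem evalHead_smul (c : k) (x : S) (f : MultilinearMap k (fun _ : Fin (n + 1) => S) N) :
    evalHead (c • x) f = c • evalHead x f := f.curryLeft.map_smul c x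

theorem evalHead_units_smul (c : kˣ) (x : S) (f : MultilinearMap k (fun _ : Fin (n + 1) => S) N) :
    evalHead (c • x) f = c • evalHead x f := f.curryLeft.map_smul (c : k) x

theorem evalHead_zero (f : MultilinearMap k (fun _ : Fin (n + 1) => S) N) :
    evalHead 0 f = 0 := f.curryLeft.map_zero

theorem ext_evalHead_of_mem (𝒮 : Γ → Submodule k S) [DirectSum.Decomposition 𝒮]
    {f g : MultilinearMap k (fun _ : Fin (n + 1) => S) N}
    (h : ∀ (a : Γ) (x : S), x ∈ 𝒮 a → evalHead x f = evalHead x g) : f = g := by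
  have : f.curryLeft = g.curryLeft := LinearMap.ext_homogeneous 𝒮 h
  rw [← f.uncurry_curryLeft, this, g.uncurry_curryLeft]

theorem ext_evalHead {f g : MultilinearMap k (fun _ : Fin (n + 1) => S) N}
    (h : ∀ x : S, evalHead x f = evalHead x g) : f = g := by
  have : f.curryLeft = g.curryLeft := LinearMap.ext h
  rw [← f.uncurry_curryLeft, this, g.uncurry_curryLeft]

end evalHead

theorem MultilinearMap.ext_homogeneous (𝒮 : Γ → Submodule k S) [DirectSum.Decomposition 𝒮]
    {N : Type*} [AddCommGroup N] [Module k N] {n : ℕ}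
    {f g : MultilinearMap k (fun _ : Fin n => S) N}
    (h : ∀ (α : Fin n → Γ) (v : Fin n → S), (∀ s, v s ∈ 𝒮 (α s)) → f v = g v) : f = g := by
  induction n with
  | zero => ext v; exact h Fin.elim0 v (fun s => s.elim0)
  | succ n ih =>
    refine ext_evalHead_of_mem 𝒮 fun a x hx => ih fun α v hv => ?_
    exact h (Fin.cons a α) (Fin.cons x v) (Fin.cases hx hv)

theorem extendHomogeneous_apply {N : Type*} [AddCommGroup N] [Module k N] {n : ℕ}
    (F : (Fin n → Γ) → MultilinearMap k (fun _ : Fin n => S) N) {α : Fin n → Γ} {v : Fin n → S}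
    (hv : ∀ s, v s ∈ 𝒮 (α s)) : extendHomogeneous 𝒮 F v = F α v := by
  have h : (fun s => DirectSum.decompose 𝒮 (v s)) =
      fun s => DirectSum.lof k Γ (fun γ => 𝒮 γ) (α s) ⟨v s, hv s⟩ := by
    ext1 s
    rw [DirectSum.lof_eq_of]
    exact DirectSum.decompose_of_mem 𝒮 (hv s)
  simp only [extendHomogeneous, LinearMap.coe_mk, AddHom.coe_mk, MultilinearMap.compLinearMap_apply,
    LinearEquiv.coe_coe, DirectSum.decomposeLinearEquiv_apply]
  -- Each argument has a single nonzero component, so only the member of the family indexed by α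
  -- survives.
  erw [h, MultilinearMap.fromDirectSumEquiv_lof]
  rfl

theorem cochainScale_apply {n : ℕ} (a : Γ) (f : TensorCochain k S M n) (v : Fin n → S) (y : S) :
    cochainScale ε 𝒮 ℳ n a f v y = degreeScale ε ℳ a
      (f (fun s => degreeScale ε 𝒮 (-a) (v s)) (degreeScale ε 𝒮 (-a) y)) := rfl

/-- Contraction with x raises the degree from β to β + b, and ε(β, a) = ε(a, b) ε(β + b, a). -/
theorem evalHead_cochainScale {n : ℕ} (a : Γ) (f : TensorCochain k S M (n + 1)) {b : Γ} {x : S}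
    (hx : x ∈ 𝒮 b) :
    evalHead x (cochainScale ε 𝒮 ℳ (n + 1) a f) =
      ε a b • cochainScale ε 𝒮 ℳ n a (evalHead x f) := by
  have hx' : degreeScale ε 𝒮 (-a) x = ε a b • x := by
    rw [degreeScale_of_mem _ hx, ε.val_neg_right]
  ext v y
  have h : (fun s => degreeScale ε 𝒮 (-a) ((Fin.cons x v : Fin (n + 1) → S) s)) =
      Fin.cons (ε a b • x) (fun s => degreeScale ε 𝒮 (-a) (v s)) := by
    ext s; refine Fin.cases ?_ (fun s => ?_) s <;> simp [hx']
  rw [evalHead_apply, cochainScale_apply, h, ← evalHead_apply, evalHead_units_smul]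
  simp [cochainScale_apply, Units.smul_def]

/-! ### Peeling off the first argument of the operators `D_t` -/

theorem Fin.removeNth_succ_cons {n : ℕ} {X : Type*} (t : Fin (n + 1)) (x : X) (v : Fin (n + 1) → X) :
    t.succ.removeNth (Fin.cons x v : Fin (n + 2) → X) =
      (Fin.cons x (t.removeNth v) : Fin (n + 1) → X) := by
  ext s
  refine Fin.cases ?_ (fun s => ?_) s <;> simp [Fin.removeNth]

namespace GenLeftSymmBimodule

variable {A : GenLeftSymmAlgebra ε 𝒮} (B : GenLeftSymmBimodule A ℳ)

/-- The sums run over all indices with conditions in the summands, so that `Fin.sum_univ_succ` can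
split off the first argument. -/
theorem face_apply {n : ℕ} (t : Fin (n + 1)) (f : TensorCochain k S M n) {α : Fin (n + 1) → Γ}
    {v : Fin (n + 1) → S} (hv : ∀ s, v s ∈ 𝒮 (α s)) :
    B.face n t f v =
      ε (∑ s, if s < t then α s else 0) (α t) •
        B.actValue (v t) (cochainScale ε 𝒮 ℳ n (α t) f (t.removeNth v))
      - ε (α t) (∑ s, if t < s then α s else 0) • B.actLast (v t) (f (t.removeNth v))
      + ε (α t) (∑ s, if t < s then α s else 0) • B.actRight (v t) (f (t.removeNth v))
      - ∑ j, if t < j then ε (α t) (∑ s, if t < s ∧ s < j then α s else 0) •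
          f (t.removeNth (Function.update v j (A.bracket (α t) (α j) (v t) (v j)))) else 0 := by
  have h₁ : Finset.Iio t = Finset.univ.filter (fun s => s < t) := by ext; simp
  have h₂ : Finset.Ioi t = Finset.univ.filter (fun s => t < s) := by ext; simp
  have h₃ (j : Fin (n + 1)) : Finset.Ioo t j = Finset.univ.filter (fun s => t < s ∧ s < j) := by
    ext; simp
  rw [face, LinearMap.comp_apply, extendHomogeneous_apply _ hv]
  simp only [← Finset.sum_filter, ← h₁, ← h₂, ← h₃]
  have h₄ (G : Fin (n + 1) → S →ₗ[k] M) :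
      ∑ j ∈ Finset.Ioi t, G j = ∑ j : {j // t < j}, G j :=
    Finset.sum_subtype (Finset.Ioi t) (by simp) G
  rw [h₄]
  simp [insertTerm, bracketTerm, Units.smul_def, LinearMap.sum_apply]

/-- An argument in front of the active one enters only through the factor of the first term. There
its degree counts as part of α₁ + ⋯ + α_{t-1} on the left and as part of the degree of the
contracted cochain on the right. -/
theorem evalHead_face_succ {n : ℕ} (t : Fin (n + 1)) (f : TensorCochain k S M (n + 1)) (x : S) :
    evalHead x (B.face (n + 1) t.succ f) = B.face n t (evalHead x f) := by
  induction x using DirectSum.Decomposition.inductionOn 𝒮 with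
  | zero => rw [evalHead_zero, evalHead_zero, map_zero]
  | add x y hx hy => rw [evalHead_add, evalHead_add, hx, hy, map_add]
  | @homogeneous a x =>
    refine MultilinearMap.ext_homogeneous 𝒮 fun α v hv => ?_
    have hv' : ∀ s, (Fin.cons (x : S) v : Fin (n + 2) → S) s ∈
      𝒮 ((Fin.cons a α : Fin (n + 2) → Γ) s) := Fin.cases x.2 hv
    rw [evalHead_apply, B.face_apply _ _ hv', B.face_apply _ _ hv, Fin.removeNth_succ_cons]
    rw [← evalHead_apply, evalHead_cochainScale _ _ x.2]
    rw [Fin.sum_univ_succ (n := n + 1), Fin.sum_univ_succ (n := n + 1),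
      Fin.sum_univ_succ (n := n + 1)]
    simp only [Fin.sum_univ_succ (n := n + 1), Fin.cons_zero, Fin.cons_succ, Fin.succ_lt_succ_iff,
      Fin.succ_pos, Fin.not_lt_zero, if_true, if_false, zero_add, false_and, ← Fin.cons_update,
      Fin.removeNth_succ_cons, evalHead_apply, smul_apply]
    -- The factor ε(a, α_t) from the longer partial sum has to cancel ε(α_t, a) from
    -- `evalHead_cochainScale`.
    rw [ε.val_add_left, mul_comm (ε a (α t)), mul_smul]
    congr 4
    simp only [Units.smul_def, map_smul, smul_smul, ← Units.val_mul, ε.val_mul_val_swap]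
    simp

/-- The bracket summand that meets the second argument y gives the last term. In all other terms y
is a spectator, and moving x past it costs ε(a, b); in the first term this uses ε(β, a) = ε(a, b)
ε(β + b, a). -/
theorem evalHead_evalHead_face_zero {n : ℕ} (f : TensorCochain k S M (n + 1)) {a b : Γ} {x y : S}
    (hx : x ∈ 𝒮 a) (hy : y ∈ 𝒮 b) :
    evalHead y (evalHead x (B.face (n + 1) 0 f)) =
      ε a b • evalHead x (B.face n 0 (evalHead y f)) - evalHead (A.bracket a b x y) f := by
  refine MultilinearMap.ext_homogeneous 𝒮 fun α v hv => ?_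
  have hv₁ : ∀ s, (Fin.cons x v : Fin (n + 1) → S) s ∈
    𝒮 ((Fin.cons a α : Fin (n + 1) → Γ) s) := Fin.cases hx hv
  have hv₂ : ∀ s, (Fin.cons x (Fin.cons y v : Fin (n + 1) → S) : Fin (n + 2) → S) s ∈
    𝒮 ((Fin.cons a (Fin.cons b α : Fin (n + 1) → Γ) : Fin (n + 2) → Γ) s) :=
    Fin.cases hx (Fin.cases hy hv)
  rw [evalHead_apply, evalHead_apply, B.face_apply _ _ hv₂, sub_apply,
    smul_apply, evalHead_apply, B.face_apply _ _ hv₁]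
  have hs : cochainScale ε 𝒮 ℳ (n + 1) a f (Fin.cons y v) =
      ε a b • cochainScale ε 𝒮 ℳ n a (evalHead y f) v := by
    rw [← evalHead_apply, evalHead_cochainScale _ _ hy, smul_apply]
  simp only [Fin.sum_univ_succ (n := n + 1), Fin.sum_univ_succ (n := n),
    Fin.cons_zero, Fin.cons_succ, Fin.succ_pos, Fin.not_lt_zero, lt_self_iff_false,
    Fin.succ_lt_succ_iff, if_true, if_false, zero_add, Finset.sum_const_zero, true_and,
    false_and, ← Fin.cons_update, Fin.removeNth_zero, Fin.tail_cons, hs,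
    evalHead_apply, ε.val_zero_left, ε.val_zero_right, ε.val_add_right, one_smul,
    Fin.update_cons_zero]
  simp only [smul_sub, smul_add, mul_smul, Finset.smul_sum, Units.smul_def, map_smul,
    one_smul]
  abel

/-- The operator by which `x ∈ S_a` acts on `Hom(S, M)`. -/
def act (a : Γ) (x : S) (g : S →ₗ[k] M) : S →ₗ[k] M :=
  B.left x ∘ₗ (degreeScale ε ℳ a ∘ₗ g ∘ₗ degreeScale ε 𝒮 (-a)) - g ∘ₗ A.mul x + B.right (g x)

theorem evalHead_face_zero (f : TensorCochain k S M 0) {a : Γ} {x : S} (hx : x ∈ 𝒮 a)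
    (v : Fin 0 → S) : evalHead x (B.face 0 0 f) v = B.act a x (f v) := by
  rw [evalHead_apply, B.face_apply (α := fun _ => a) 0 f (by simpa using hx)]
  have h : (fun s => degreeScale ε 𝒮 (-a) (v s)) = v := Subsingleton.elim _ _
  ext y
  simp [act, actValue, actLast, actRight, ε.val_zero_left, ε.val_zero_right, cochainScale_apply, h]

end GenLeftSymmBimodule

/-! ### The `ε`-Lie structure and its action on `Hom(S, M)` -/

theorem degreeScale_degreeScale {V : Type*} [AddCommGroup V] [Module k V]
    {𝒱 : Γ → Submodule k V} [DirectSum.Decomposition 𝒱] (a b : Γ) (x : V) :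
    degreeScale ε 𝒱 a (degreeScale ε 𝒱 b x) = degreeScale ε 𝒱 (a + b) x := by
  have : degreeScale ε 𝒱 a ∘ₗ degreeScale ε 𝒱 b = degreeScale ε 𝒱 (a + b) := by
    refine LinearMap.ext_homogeneous 𝒱 fun c x hx => ?_
    simp only [LinearMap.comp_apply, degreeScale_of_mem _ hx, Units.smul_def, map_smul,
      ε.val_add_right, smul_smul, Units.val_mul, mul_comm]
  exact LinearMap.congr_fun this x

namespace GenLeftSymmAlgebra

variable (A : GenLeftSymmAlgebra ε 𝒮)

theorem bracket_apply (a b : Γ) (x y : S) :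
    A.bracket a b x y = A.mul x y - ε a b • A.mul y x := rfl

theorem bracket_mem {a b : Γ} {x y : S} (hx : x ∈ 𝒮 a) (hy : y ∈ 𝒮 b) :
    A.bracket a b x y ∈ 𝒮 (a + b) :=
  (𝒮 _).sub_mem (A.mul_mem hx hy)
    ((𝒮 _).smul_mem (ε a b : k) (add_comm b a ▸ A.mul_mem hy hx))

theorem smul_bracket_swap (a b : Γ) (x y : S) :
    ε a b • A.bracket b a y x = -A.bracket a b x y := by
  simp [bracket_apply, smul_sub, smul_smul, ε.val_mul_val_swap]

/-- The Jacobi defect of the commutator is a combination of associators, which cancel in pairs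
because the associator is `ε`-symmetric in its first two arguments. -/
theorem jacobi {a b c : Γ} {x y z : S} (hx : x ∈ 𝒮 a) (hy : y ∈ 𝒮 b) (hz : z ∈ 𝒮 c) :
    A.bracket a (b + c) x (A.bracket b c y z) =
      A.bracket (a + b) c (A.bracket a b x y) z +
        ε a b • A.bracket b (a + c) y (A.bracket a c x z) := by
  have h₁ := A.left_symm z hx hy
  have h₂ := A.left_symm y hx hz
  have h₃ := A.left_symm x hy hz
  -- `module` treats the values of `ε` as independent scalars, so this relation has to be supplied
  -- with each term where it is used.
  have e : (ε a b : k) * ε b a = 1 := by rw [← Units.val_mul, ε.val_mul_val_swap, Units.val_one]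
  simp only [bracket_apply, map_sub, map_smul, LinearMap.sub_apply, LinearMap.smul_apply,
    Units.smul_def, ε.val_add_left, ε.val_add_right, Units.val_mul] at *
  linear_combination (norm := module) (-1 : k) • h₁ + (ε b c : k) • h₂ - ((ε a b : k) * ε a c) • h₃ +
    e • ((ε b c : k) • A.mul (A.mul x z) y) - e • (((ε b c : k) * ε a c) • A.mul (A.mul z x) y)

end GenLeftSymmAlgebra

namespace GenLeftSymmBimodule

variable {A : GenLeftSymmAlgebra ε 𝒮} (B : GenLeftSymmBimodule A ℳ)

theorem degreeScale_left (a : Γ) {b : Γ} {x : S} (hx : x ∈ 𝒮 b) (m : M) :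
    degreeScale ε ℳ a (B.left x m) = ε b a • B.left x (degreeScale ε ℳ a m) := by
  have : degreeScale ε ℳ a ∘ₗ B.left x = ε b a • B.left x ∘ₗ degreeScale ε ℳ a := by
    refine LinearMap.ext_homogeneous ℳ fun c m hm => ?_
    simp [degreeScale_of_mem _ hm, degreeScale_of_mem _ (B.left_mem hx hm), Units.smul_def,
      ε.val_add_left, smul_smul]
  exact LinearMap.congr_fun this m

theorem degreeScale_right (a : Γ) {b : Γ} {x : S} (hx : x ∈ 𝒮 b) (m : M) :
    degreeScale ε ℳ a (B.right m x) = ε b a • B.right (degreeScale ε ℳ a m) x := by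
  have : degreeScale ε ℳ a ∘ₗ B.right.flip x = ε b a • B.right.flip x ∘ₗ degreeScale ε ℳ a := by
    refine LinearMap.ext_homogeneous ℳ fun c m hm => ?_
    simp [degreeScale_of_mem _ hm, degreeScale_of_mem _ (B.right_mem hm hx), Units.smul_def,
      ε.val_add_left, smul_smul, mul_comm]
  exact LinearMap.congr_fun this m

/-- The mixed bimodule identity, for a not necessarily homogeneous element of the module. -/
theorem left_right_degreeScale {a : Γ} {x : S} (hx : x ∈ 𝒮 a) (m : M) (y : S) :
    B.right (B.left x (degreeScale ε ℳ a m)) y - B.left x (B.right (degreeScale ε ℳ a m) y) =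
      B.right (B.right m x) y - B.right m (A.mul x y) := by
  have : (B.right.flip y ∘ₗ B.left x - B.left x ∘ₗ B.right.flip y) ∘ₗ degreeScale ε ℳ a =
      B.right.flip y ∘ₗ B.right.flip x - B.right.flip (A.mul x y) := by
    refine LinearMap.ext_homogeneous ℳ fun c m hm => ?_
    have h := B.left_right y hx hm
    simp only [LinearMap.comp_apply, LinearMap.sub_apply, degreeScale_of_mem _ hm,
      LinearMap.flip_apply, Units.smul_def, map_smul] at h ⊢
    rw [h, smul_smul, ← Units.val_mul, ε.val_mul_val_swap, Units.val_one, one_smul]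
  exact LinearMap.congr_fun this m

theorem act_apply {a c : Γ} (x : S) {z : S} (hz : z ∈ 𝒮 c) (g : S →ₗ[k] M) :
    B.act a x g z = ε a c • B.left x (degreeScale ε ℳ a (g z)) - g (A.mul x z) +
      B.right (g x) z := by
  simp [act, degreeScale_of_mem _ hz, ε.val_neg_right, Units.smul_def]

/-- This is the usual representation relation; ε(a, b) sits at the other product because L_x carries
the factor ε(β, a) for moving x past a cochain of degree β. At z, the double left actions on g(z)
cancel by `left_left`, the values of g at products by left symmetry of S, and the terms with a right
action by the mixed axiom for y on g(x) and for x on g(y). -/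
theorem act_act {a b : Γ} {x y : S} (hx : x ∈ 𝒮 a) (hy : y ∈ 𝒮 b) (g : S →ₗ[k] M) :
    B.act b y (B.act a x g) =
      ε a b • B.act a x (B.act b y g) - B.act (a + b) (A.bracket a b x y) g := by
  refine LinearMap.ext_homogeneous 𝒮 fun c z hz => ?_
  have h₁ := B.left_left (degreeScale ε ℳ (a + b) (g z)) hx hy
  have h₂ := congrArg g (A.left_symm z hx hy)
  have h₃ := B.left_right_degreeScale hy (g x) z
  have h₄ := B.left_right_degreeScale hx (g y) z
  have e : (ε a b : k) * ε b a = 1 := by rw [← Units.val_mul, ε.val_mul_val_swap, Units.val_one]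
  have e₁ : (ε a c : k) * ε c a = 1 := by rw [← Units.val_mul, ε.val_mul_val_swap, Units.val_one]
  have e₂ : (ε b c : k) * ε c b = 1 := by rw [← Units.val_mul, ε.val_mul_val_swap, Units.val_one]
  simp only [LinearMap.sub_apply, LinearMap.smul_apply, Units.smul_def]
  simp only [B.act_apply _ hz, B.act_apply _ hx, B.act_apply _ hy,
    B.act_apply _ (A.mul_mem hx hz), B.act_apply _ (A.mul_mem hy hz)]
  simp only [Units.smul_def, map_add, map_sub, map_smul, LinearMap.add_apply, LinearMap.sub_apply,
    LinearMap.smul_apply, B.degreeScale_left _ hx, B.degreeScale_left _ hy,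
    B.degreeScale_right _ hz, degreeScale_degreeScale, A.bracket_apply, ε.val_add_left,
    ε.val_add_right, Units.val_mul, add_comm b a] at *
  linear_combination (norm := module) ((ε a c : k) * ε b c) • h₁ - h₂ - h₃ + (ε a b : k) • h₄ +
    e₂ • B.left y (B.right (degreeScale ε ℳ b (g x)) z) -
    e₁ • ((ε a b : k) • B.left x (B.right (degreeScale ε ℳ a (g y)) z)) -
    e • (((ε a c : k) * ε b c) • B.left x (B.left y (degreeScale ε ℳ (a + b) (g z)))) +
    e • ((ε b c : k) • B.left y (degreeScale ε ℳ b (g (A.mul x z)))) -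
    e • B.right (B.left y (degreeScale ε ℳ b (g x))) z

end GenLeftSymmBimodule

/-! ### The pre-simplicial identities -/

namespace GenLeftSymmBimodule

variable {A : GenLeftSymmAlgebra ε 𝒮} (B : GenLeftSymmBimodule A ℳ)

theorem D_succ {n : ℕ} (t : Fin (n + 1)) : B.D (t + 1) n = B.face n t := by
  rw [D, dif_pos (by omega)]
  rfl

theorem D_one (n : ℕ) : B.D 1 n = B.face n 0 := B.D_succ 0

theorem D_of_lt {t n : ℕ} (h : n + 1 < t) : B.D t n = 0 := dif_neg (by omega)

theorem evalHead_D (t n : ℕ) (f : TensorCochain k S M (n + 1)) (x : S) :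
    evalHead x (B.D (t + 2) (n + 1) f) = B.D (t + 1) n (evalHead x f) := by
  by_cases h : t < n + 1
  · have h₁ := B.D_succ (⟨t, h⟩ : Fin (n + 1))
    have h₂ := B.D_succ (⟨t, h⟩ : Fin (n + 1)).succ
    simp only [Fin.val_succ] at h₁ h₂
    rw [h₁, h₂, evalHead_face_succ]
  -- Both indices leave their ranges at the same t, so the convention D_t = 0 respects the shift.
  · rw [D_of_lt _ (by omega), D_of_lt _ (by omega)]
    simp

/-- The action of `x ∈ S` on tensor cochains, `(D₁ f)(x, …)`. -/
def lieAct (n : ℕ) (x : S) : TensorCochain k S M n →ₗ[k] TensorCochain k S M n :=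
  evalHead x ∘ₗ B.D 1 n

theorem evalHead_D_one (n : ℕ) (f : TensorCochain k S M n) (x : S) :
    evalHead x (B.D 1 n f) = B.lieAct n x f := rfl

theorem lieAct_zero_apply (f : TensorCochain k S M 0) {a : Γ} {x : S} (hx : x ∈ 𝒮 a)
    (v : Fin 0 → S) : B.lieAct 0 x f v = B.act a x (f v) := by
  rw [← evalHead_D_one, D_one, evalHead_face_zero _ _ hx]

theorem evalHead_lieAct {n : ℕ} (f : TensorCochain k S M (n + 1)) {a b : Γ} {x y : S}
    (hx : x ∈ 𝒮 a) (hy : y ∈ 𝒮 b) :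
    evalHead y (B.lieAct (n + 1) x f) =
      ε a b • B.lieAct n x (evalHead y f) - evalHead (A.bracket a b x y) f := by
  rw [← evalHead_D_one, ← evalHead_D_one, D_one, D_one, evalHead_evalHead_face_zero _ _ hx hy]

/-- Contract with z and move ι_z inward: the L-terms agree by induction, and the terms in which z is
bracketed twice agree by Jacobi. -/
theorem lieAct_lieAct {n : ℕ} (f : TensorCochain k S M n) {a b : Γ} {x y : S}
    (hx : x ∈ 𝒮 a) (hy : y ∈ 𝒮 b) :
    B.lieAct n y (B.lieAct n x f) =
      ε a b • B.lieAct n x (B.lieAct n y f) - B.lieAct n (A.bracket a b x y) f := by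
  induction n with
  | zero =>
    ext1 v
    simp only [sub_apply, smul_apply, B.lieAct_zero_apply _ hx, B.lieAct_zero_apply _ hy,
      B.lieAct_zero_apply _ (A.bracket_mem hx hy), B.act_act hx hy]
  | succ n ih =>
    refine ext_evalHead_of_mem 𝒮 fun c z hz => ?_
    have h₁ := ih (evalHead z f)
    have h₂ := congrArg (fun w => evalHead w f) (A.jacobi hx hy hz)
    have e : (ε a b : k) * ε b a = 1 := by
      rw [← Units.val_mul, ε.val_mul_val_swap, Units.val_one]
    simp only [Units.smul_def, map_sub, map_smul, evalHead_add, evalHead_smul] at h₁ h₂ ⊢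
    simp only [B.evalHead_lieAct _ hx hz, B.evalHead_lieAct _ hy hz,
      B.evalHead_lieAct _ (A.bracket_mem hx hy) hz, B.evalHead_lieAct _ hx (A.bracket_mem hy hz),
      B.evalHead_lieAct _ hy (A.bracket_mem hx hz), Units.smul_def, map_sub, map_smul,
      ε.val_add_left, ε.val_add_right, Units.val_mul] at *
    linear_combination (norm := module) ((ε a c : k) * ε b c) • h₁ + h₂ +
      e • ((ε b c : k) • B.lieAct n y (evalHead (A.bracket a c x z) f))

theorem lieAct_add (n : ℕ) (x y : S) (f : TensorCochain k S M n) :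
    B.lieAct n (x + y) f = B.lieAct n x f + B.lieAct n y f := evalHead_add x y _

theorem lieAct_zero (n : ℕ) (f : TensorCochain k S M n) : B.lieAct n 0 f = 0 := evalHead_zero _

/-- For D₁, contraction with y turns the claim into `lieAct_lieAct`; higher operators reduce to it
because contraction lowers the index. -/
theorem lieAct_D (t n : ℕ) (f : TensorCochain k S M n) (x : S) :
    B.lieAct (n + 1) x (B.D (t + 1) n f) = B.D (t + 1) n (B.lieAct n x f) := by
  -- Both sides are additive in x and no degree of x occurs in the statement, so homogeneous x
  -- suffice.
  induction x using DirectSum.Decomposition.inductionOn 𝒮 with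
  | zero => rw [lieAct_zero, lieAct_zero, map_zero]
  | add x y hx hy => rw [lieAct_add, lieAct_add, hx, hy, map_add]
  | @homogeneous a x =>
    obtain ⟨x, hx⟩ := x
    induction t generalizing n with
    | zero =>
      refine ext_evalHead_of_mem 𝒮 fun b y hy => ?_
      rw [B.evalHead_lieAct _ hx hy, zero_add, evalHead_D_one, evalHead_D_one, evalHead_D_one,
        B.lieAct_lieAct f hx hy]
    | succ t ih =>
      cases n with
      | zero => simp [D_of_lt]
      | succ n =>
        refine ext_evalHead_of_mem 𝒮 fun b y hy => ?_
        rw [B.evalHead_lieAct _ hx hy, evalHead_D, evalHead_D, evalHead_D, ih,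
          B.evalHead_lieAct _ hx hy, map_sub]
        simp only [Units.smul_def, map_smul]

/-- Contraction lowers both indices until the smaller operator is D₁; one more contraction replaces
D₁ by L_x, which commutes with the other operator. -/
theorem D_D (s t n : ℕ) (h : s < t) (f : TensorCochain k S M n) :
    B.D (t + 1) (n + 1) (B.D (s + 1) n f) = B.D (s + 1) (n + 1) (B.D t n f) := by
  induction s generalizing t n with
  | zero =>
    obtain ⟨t, rfl⟩ := Nat.exists_eq_add_of_lt h
    simp only [zero_add] at h ⊢
    refine ext_evalHead fun x => ?_
    rw [evalHead_D, evalHead_D_one, evalHead_D_one, lieAct_D]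
  | succ s ih =>
    obtain ⟨t, rfl⟩ : ∃ r, t = r + 2 := ⟨t - 2, by omega⟩
    cases n with
    | zero => simp [D_of_lt]
    | succ n =>
      refine ext_evalHead fun x => ?_
      rw [evalHead_D, evalHead_D, evalHead_D, evalHead_D, ih _ _ (by omega)]

/-! ### The differential -/

theorem tensorDiff_apply (n : ℕ) (f : TensorCochain k S M n) :
    B.tensorDiff n f = ∑ t ∈ Finset.range (n + 1), (-1 : k) ^ t • B.D (t + 1) n f := by
  have h : Finset.Icc 1 (n + 1) = Finset.Ico (0 + 1) (n + 1 + 1) := by ext; simp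
  rw [tensorDiff, h, ← Finset.sum_Ico_add', ← Finset.range_eq_Ico, LinearMap.neg_apply,
    LinearMap.sum_apply, ← Finset.sum_neg_distrib]
  refine Finset.sum_congr rfl fun t _ => ?_
  rw [LinearMap.smul_apply, pow_succ]
  module

theorem evalHead_tensorDiff_zero (f : TensorCochain k S M 0) (x : S) :
    evalHead x (B.tensorDiff 0 f) = B.lieAct 0 x f := by
  simp [tensorDiff_apply, evalHead_D_one]

/-- Cartan's formula ι_x d + d ι_x = L_x: the index shift under contraction flips the sign of every
summand but D₁. -/
theorem evalHead_tensorDiff_succ (n : ℕ) (f : TensorCochain k S M (n + 1)) (x : S) :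
    evalHead x (B.tensorDiff (n + 1) f) =
      B.lieAct (n + 1) x f - B.tensorDiff n (evalHead x f) := by
  rw [tensorDiff_apply, tensorDiff_apply, Finset.sum_range_succ', map_add, map_sum, sub_eq_neg_add,
    ← Finset.sum_neg_distrib]
  simp only [map_smul, evalHead_D, zero_add, evalHead_D_one, pow_zero, one_smul]
  congr 1
  refine Finset.sum_congr rfl fun t _ => ?_
  rw [pow_succ]
  module

theorem lieAct_tensorDiff (n : ℕ) (f : TensorCochain k S M n) (x : S) :
    B.lieAct (n + 1) x (B.tensorDiff n f) = B.tensorDiff n (B.lieAct n x f) := by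
  simp only [tensorDiff_apply, map_sum, map_smul, lieAct_D]

theorem tensorDiff_tensorDiff (n : ℕ) (f : TensorCochain k S M n) :
    B.tensorDiff (n + 1) (B.tensorDiff n f) = 0 := by
  induction n with
  | zero =>
    refine ext_evalHead fun x => ?_
    rw [evalHead_tensorDiff_succ, evalHead_tensorDiff_zero, lieAct_tensorDiff, sub_self, map_zero]
  | succ n ih =>
    refine ext_evalHead fun x => ?_
    rw [evalHead_tensorDiff_succ, evalHead_tensorDiff_succ, lieAct_tensorDiff, map_sub, ih,
      sub_zero, sub_self, map_zero]

end GenLeftSymmBimodule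

/-! ### Homogeneity -/

theorem mem_homogeneousTensorCochain_succ {n : ℕ} {β : Γ} {f : TensorCochain k S M (n + 1)} :
    f ∈ homogeneousTensorCochain 𝒮 ℳ (n + 1) β ↔
      ∀ (a : Γ) (x : S), x ∈ 𝒮 a →
        evalHead x f ∈ homogeneousTensorCochain 𝒮 ℳ n (β + a) := by
  constructor
  · intro h a x hx α δ v y hv hy
    have := h (Fin.cons a α) δ (Fin.cons x v) y (Fin.cases hx hv) hy
    rwa [Fin.sum_cons, ← add_assoc] at this
  · intro h α δ v y hv hy
    have := h (α 0) (v 0) (hv 0) (fun s => α s.succ) δ (fun s => v s.succ) y (fun s => hv _) hy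
    rw [Fin.sum_univ_succ, ← add_assoc]
    rwa [evalHead_apply, show Fin.cons (v 0) (fun s => v s.succ) = v from Fin.cons_self_tail v]
      at this

namespace GenLeftSymmBimodule

variable {A : GenLeftSymmAlgebra ε 𝒮} (B : GenLeftSymmBimodule A ℳ)

theorem lieAct_mem {n : ℕ} {a β : Γ} {x : S} (hx : x ∈ 𝒮 a) {f : TensorCochain k S M n}
    (hf : f ∈ homogeneousTensorCochain 𝒮 ℳ n β) :
    B.lieAct n x f ∈ homogeneousTensorCochain 𝒮 ℳ n (β + a) := by
  induction n generalizing β with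
  | zero =>
    intro α δ v y hv hy
    rw [B.lieAct_zero_apply _ hx, B.act_apply _ hy, degreeScale_of_mem _ (hf α δ v y hv hy)]
    have h₁ := B.left_mem hx (hf α δ v y hv hy)
    have h₂ := hf α (a + δ) v _ hv (A.mul_mem hx hy)
    have h₃ := B.right_mem (hf α a v x hv hx) hy
    simp only [Finset.univ_eq_empty, Finset.sum_empty, add_zero, ← add_assoc] at h₁ h₂ h₃ ⊢
    rw [add_comm a] at h₁
    simp only [Units.smul_def, map_smul]
    exact (ℳ _).add_mem ((ℳ _).sub_mem ((ℳ _).smul_mem _ ((ℳ _).smul_mem _ h₁)) h₂) h₃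
  | succ n ih =>
    rw [mem_homogeneousTensorCochain_succ] at hf ⊢
    intro b y hy
    rw [B.evalHead_lieAct _ hx hy]
    refine Submodule.sub_mem _ (Submodule.smul_mem _ (ε a b : k) ?_) ?_
    · rw [add_right_comm]
      exact ih (hf b y hy)
    · rw [add_assoc]
      exact hf _ _ (A.bracket_mem hx hy)

theorem D_mem (t n : ℕ) {β : Γ} {f : TensorCochain k S M n}
    (hf : f ∈ homogeneousTensorCochain 𝒮 ℳ n β) :
    B.D t n f ∈ homogeneousTensorCochain 𝒮 ℳ (n + 1) β := by
  induction n generalizing t β with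
  | zero =>
    by_cases h : t = 1
    · subst h
      exact mem_homogeneousTensorCochain_succ.2 fun a x hx => B.lieAct_mem hx hf
    · rw [D, dif_neg (by omega)]
      exact Submodule.zero_mem _
  | succ n ih =>
    match t with
    | 0 => rw [D, dif_neg (by omega)]; exact Submodule.zero_mem _
    | 1 => exact mem_homogeneousTensorCochain_succ.2 fun a x hx => B.lieAct_mem hx hf
    | t + 2 =>
      rw [mem_homogeneousTensorCochain_succ] at hf ⊢
      intro a x hx
      rw [evalHead_D]
      exact ih _ (hf a x hx)

theorem tensorDiff_mem (n : ℕ) {β : Γ} {f : TensorCochain k S M n}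
    (hf : f ∈ homogeneousTensorCochain 𝒮 ℳ n β) :
    B.tensorDiff n f ∈ homogeneousTensorCochain 𝒮 ℳ (n + 1) β := by
  rw [tensorDiff_apply]
  exact Submodule.sum_mem _ fun t _ => Submodule.smul_mem _ _ (B.D_mem _ _ hf)

/-- The value has degree β plus the degrees of the arguments; the scalings of the arguments cancel
everything but ε(β, a). -/
theorem cochainScale_of_mem {n : ℕ} (a : Γ) {β : Γ} {f : TensorCochain k S M n}
    (hf : f ∈ homogeneousTensorCochain 𝒮 ℳ n β) :
    cochainScale ε 𝒮 ℳ n a f = ε β a • f := by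
  induction n generalizing β with
  | zero =>
    ext1 v
    refine LinearMap.ext_homogeneous 𝒮 fun c y hy => ?_
    have h := hf Fin.elim0 c v y (fun s => s.elim0) hy
    have hv : (fun s => degreeScale ε 𝒮 (-a) (v s)) = v := Subsingleton.elim _ _
    rw [cochainScale_apply, hv, degreeScale_of_mem _ hy, ε.val_neg_right]
    simp only [Units.smul_def, map_smul]
    rw [degreeScale_of_mem _ h]
    simp only [Finset.univ_eq_empty, Finset.sum_empty, add_zero, ε.val_add_left, smul_apply,
      LinearMap.smul_apply, ← Units.smul_def, smul_smul]
    rw [mul_comm (ε β a), ← mul_assoc, ε.val_mul_val_swap, one_mul]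
  | succ n ih =>
    refine ext_evalHead_of_mem 𝒮 fun b x hx => ?_
    rw [evalHead_cochainScale _ _ hx, ih (mem_homogeneousTensorCochain_succ.1 hf b x hx), smul_smul,
      ε.val_add_left, mul_comm (ε β a), ← mul_assoc, ε.val_mul_val_swap, one_mul]
    simp only [Units.smul_def, map_smul]

theorem D_apply {n : ℕ} (t : Fin (n + 1)) {β : Γ} {f : TensorCochain k S M n}
    {α : Fin (n + 1) → Γ} {v : Fin (n + 1) → S} (y : S)
    (hf : f ∈ homogeneousTensorCochain 𝒮 ℳ n β) (hv : ∀ s, v s ∈ 𝒮 (α s)) :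
    B.D (t + 1) n f v y =
      ε (β + ∑ s ∈ Finset.Iio t, α s) (α t) • B.left (v t) (f (t.removeNth v) y)
      - ε (α t) (∑ s ∈ Finset.Ioi t, α s) • f (t.removeNth v) (A.mul (v t) y)
      + ε (α t) (∑ s ∈ Finset.Ioi t, α s) • B.right (f (t.removeNth v) (v t)) y
      - ∑ j ∈ Finset.Ioi t, ε (α t) (∑ s ∈ Finset.Ioo t j, α s) •
          f (t.removeNth (Function.update v j
            (A.mul (v t) (v j) - ε (α t) (α j) • A.mul (v j) (v t)))) y := by
  have h₁ : Finset.Iio t = Finset.univ.filter (fun s => s < t) := by ext; simp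
  have h₂ : Finset.Ioi t = Finset.univ.filter (fun s => t < s) := by ext; simp
  have h₃ (j : Fin (n + 1)) : Finset.Ioo t j = Finset.univ.filter (fun s => t < s ∧ s < j) := by
    ext; simp
  rw [D_succ, B.face_apply _ _ hv, cochainScale_of_mem _ hf]
  simp only [← Finset.sum_filter, ← h₁, ← h₂, ← h₃, ε.val_add_left]
  simp [actValue, actLast, actRight, A.bracket_apply, Units.smul_def, smul_smul, mul_comm]

end GenLeftSymmBimodule

/-! ### `ε`-alternating tensor cochains -/

variable (ε 𝒮 M) in
/-- The tensor cochains `f` with `f(…, x, y, …) = -ε(a, b) f(…, y, x, …)` for `x ∈ S_a` and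
`y ∈ S_b`. -/
def altTensorCochain (n : ℕ) : Submodule k (TensorCochain k S M n) where
  carrier := {f | ∀ (p q : Fin n) (v : Fin n → S) (a b : Γ), (p : ℕ) + 1 = q → v p ∈ 𝒮 a →
    v q ∈ 𝒮 b → f v + ε a b • f (v ∘ Equiv.swap p q) = 0}
  add_mem' {f g} hf hg p q v a b h hp hq := by
    rw [add_apply, add_apply, smul_add, add_add_add_comm,
      hf p q v a b h hp hq, hg p q v a b h hp hq, add_zero]
  zero_mem' _ _ _ _ _ _ _ _ := by simp
  smul_mem' c f hf p q v a b h hp hq := by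
    rw [smul_apply, smul_apply, smul_comm, ← smul_add, hf p q v a b h hp hq, smul_zero]

theorem mem_altTensorCochain_of_le_one {n : ℕ} (hn : n ≤ 1) (f : TensorCochain k S M n) :
    f ∈ altTensorCochain M ε 𝒮 n := by
  intro p q _ _ _ h
  omega

/-- An adjacent transposition either fixes the first position or swaps the first two. This form lets
alternation be proved by contraction. -/
theorem mem_altTensorCochain_add_two {n : ℕ} {f : TensorCochain k S M (n + 2)} :
    f ∈ altTensorCochain M ε 𝒮 (n + 2) ↔
      (∀ (a : Γ) (x : S), x ∈ 𝒮 a → evalHead x f ∈ altTensorCochain M ε 𝒮 (n + 1)) ∧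
      ∀ (a b : Γ) (x y : S), x ∈ 𝒮 a → y ∈ 𝒮 b →
        evalHead y (evalHead x f) + ε a b • evalHead x (evalHead y f) = 0 := by
  have hsucc (m : ℕ) (x : S) (v : Fin m → S) (p q : Fin m) :
      (Fin.cons x v : Fin (m + 1) → S) ∘ Equiv.swap p.succ q.succ =
        (Fin.cons x (v ∘ Equiv.swap p q) : Fin (m + 1) → S) := by
    ext s
    refine Fin.cases ?_ (fun s => ?_) s
    · simp [Equiv.swap_apply_of_ne_of_ne, (Fin.succ_ne_zero _).symm]
    · simp only [Function.comp_apply, Fin.cons_succ, Equiv.swap_apply_def, Fin.succ_inj]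
      split_ifs <;> simp
  have hzero (x y : S) (v : Fin n → S) :
      (Fin.cons x (Fin.cons y v : Fin (n + 1) → S) : Fin (n + 2) → S) ∘ Equiv.swap 0 1 =
        (Fin.cons y (Fin.cons x v : Fin (n + 1) → S) : Fin (n + 2) → S) := by
    ext s
    refine Fin.cases ?_ (Fin.cases ?_ fun s => ?_) s
    · rw [Function.comp_apply, Equiv.swap_apply_left]
      rfl
    · simp
    · rw [Function.comp_apply, Equiv.swap_apply_of_ne_of_ne (Fin.succ_ne_zero _) (by
        rw [← Fin.succ_zero_eq_one]; exact fun h => Fin.succ_ne_zero _ (Fin.succ_injective _ h))]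
      simp
  constructor
  · intro hf
    refine ⟨fun a x hx p q v b c h hp hq => ?_, fun a b x y hx hy => ?_⟩
    · have := hf p.succ q.succ (Fin.cons x v) b c (by simp [h]) hp hq
      rwa [hsucc] at this
    · ext1 v
      have := hf 0 1 (Fin.cons x (Fin.cons y v : Fin (n + 1) → S)) a b rfl hx hy
      rwa [hzero] at this
  · rintro ⟨h₁, h₂⟩ p q v a b h hp hq
    -- Only the two swapped arguments are assumed homogeneous, so the first one may be arbitrary.
    have h₁' (x : S) : evalHead x f ∈ altTensorCochain M ε 𝒮 (n + 1) := by
      induction x using DirectSum.Decomposition.inductionOn 𝒮 with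
      | zero => rw [evalHead_zero]; exact Submodule.zero_mem _
      | add x y hx hy => rw [evalHead_add]; exact Submodule.add_mem _ hx hy
      | homogeneous x => exact h₁ _ _ x.2
    obtain ⟨x, v, rfl⟩ : ∃ x w, v = Fin.cons x w := ⟨v 0, Fin.tail v, (Fin.cons_self_tail v).symm⟩
    induction q using Fin.cases with
    | zero => simp at h
    | succ q =>
      induction p using Fin.cases with
      | succ p =>
        rw [hsucc]
        exact h₁' x p q v a b (by simpa using h) hp hq
      | zero =>
        obtain rfl : q = 0 := by ext; simpa using h.symm
        obtain ⟨y, v, rfl⟩ : ∃ x w, v = Fin.cons x w :=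
          ⟨v 0, Fin.tail v, (Fin.cons_self_tail v).symm⟩
        rw [Fin.succ_zero_eq_one, hzero]
        exact congrArg (fun g => g v) (h₂ a b x y hp hq)

namespace GenLeftSymmBimodule

variable {A : GenLeftSymmAlgebra ε 𝒮} (B : GenLeftSymmBimodule A ℳ)

theorem lieAct_mem_alt {n : ℕ} {a : Γ} {x : S} (hx : x ∈ 𝒮 a) {f : TensorCochain k S M n}
    (hf : f ∈ altTensorCochain M ε 𝒮 n) : B.lieAct n x f ∈ altTensorCochain M ε 𝒮 n := by
  induction n with
  | zero => exact mem_altTensorCochain_of_le_one (by simp) _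
  | succ n ih =>
    cases n with
    | zero => exact mem_altTensorCochain_of_le_one (by simp) _
    | succ n =>
      obtain ⟨h₁, h₂⟩ := mem_altTensorCochain_add_two.1 hf
      refine mem_altTensorCochain_add_two.2 ⟨fun b y hy => ?_, fun b c y z hy hz => ?_⟩
      · rw [B.evalHead_lieAct _ hx hy]
        exact Submodule.sub_mem _ (Submodule.smul_mem _ (ε a b : k) (ih (h₁ b y hy)))
          (h₁ _ _ (A.bracket_mem hx hy))
      -- Moving both contractions past L_x leaves L_x applied to the relation for (y, z), and the
      -- relations for ([x, y], z) and (y, [x, z]).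
      · have g₁ := congrArg (B.lieAct n x) (h₂ b c y z hy hz)
        have g₂ := h₂ _ _ _ _ (A.bracket_mem hx hy) hz
        have g₃ := h₂ _ _ _ _ hy (A.bracket_mem hx hz)
        have e : (ε b a : k) * ε a b = 1 := by
          rw [← Units.val_mul, ε.val_mul_val_swap, Units.val_one]
        simp only [B.evalHead_lieAct _ hx hy, B.evalHead_lieAct _ hx hz, map_sub, Units.smul_def,
          map_smul, map_add, map_zero, ε.val_add_left, ε.val_add_right, Units.val_mul] at *
        linear_combination (norm := module) ((ε a b : k) * ε a c) • g₁ - g₂ - (ε a b : k) • g₃ +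
          e • ((ε b c : k) • evalHead y (evalHead (A.bracket a c x z) f))

/-- Contracting df with x and y by Cartan's formula, the bracket terms cancel by `ε`-antisymmetry;
what remains is d applied to the alternation relation of f, up to sign. -/
theorem tensorDiff_mem_alt {n : ℕ} {f : TensorCochain k S M n}
    (hf : f ∈ altTensorCochain M ε 𝒮 n) : B.tensorDiff n f ∈ altTensorCochain M ε 𝒮 (n + 1) := by
  induction n with
  | zero => exact mem_altTensorCochain_of_le_one (by simp) _
  | succ n ih =>
    have h₁ : ∀ (a : Γ) (x : S), x ∈ 𝒮 a → evalHead x f ∈ altTensorCochain M ε 𝒮 n := by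
      cases n with
      | zero => exact fun _ _ _ => mem_altTensorCochain_of_le_one (by simp) _
      | succ n => exact (mem_altTensorCochain_add_two.1 hf).1
    refine mem_altTensorCochain_add_two.2 ⟨fun a x hx => ?_, fun a b x y hx hy => ?_⟩
    · rw [evalHead_tensorDiff_succ]
      exact Submodule.sub_mem _ (B.lieAct_mem_alt hx hf) (ih (h₁ a x hx))
    · have g := congrArg (fun w => evalHead w f) (A.smul_bracket_swap a b x y)
      have hneg : evalHead (-A.bracket a b x y) f = -evalHead (A.bracket a b x y) f :=
        f.curryLeft.map_neg _
      have e : (ε a b : k) * ε b a = 1 := by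
        rw [← Units.val_mul, ε.val_mul_val_swap, Units.val_one]
      simp only [evalHead_units_smul, hneg] at g
      -- Since ι_y d - L_y = -d ι_y, the left side is -d(ι_y ι_x f + ε(a, b) ι_x ι_y f). When f has
      -- only one argument before the last, ι_y d = L_y and each bracket vanishes.
      have key : evalHead y (B.tensorDiff n (evalHead x f)) - B.lieAct n y (evalHead x f) +
          ε a b • (evalHead x (B.tensorDiff n (evalHead y f)) -
            B.lieAct n x (evalHead y f)) = 0 := by
        cases n with
        | zero => simp [evalHead_tensorDiff_zero]
        | succ n =>
          have h₂ := congrArg (B.tensorDiff n) ((mem_altTensorCochain_add_two.1 hf).2 a b x y hx hy)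
          rw [evalHead_tensorDiff_succ, evalHead_tensorDiff_succ]
          simp only [Units.smul_def, map_add, map_smul, map_zero] at h₂ ⊢
          linear_combination (norm := module) (-1 : k) • h₂
      simp only [evalHead_tensorDiff_succ, map_sub, B.evalHead_lieAct _ hx hy,
        B.evalHead_lieAct _ hy hx, Units.smul_def] at *
      linear_combination (norm := module) (-1 : k) • key - g + e • B.lieAct n y (evalHead x f)

end GenLeftSymmBimodule

/-! ### Cochains on the `ε`-exterior power as alternating tensor cochains -/

theorem Cochain.toTensor_apply {n : ℕ} (f : Cochain M ε 𝒮 n) (v : Fin n → S) (y : S) :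
    f.toTensor v y = f (wedge ε 𝒮 n v ⊗ₜ y) := rfl

theorem Cochain.toTensor_injective {n : ℕ} :
    Function.Injective (Cochain.toTensor : Cochain M ε 𝒮 n →ₗ[k] TensorCochain k S M n) := by
  intro f g h
  apply TensorProduct.curry_injective
  apply Submodule.linearMap_qext
  apply PiTensorProduct.ext
  exact h

theorem Cochain.range_toTensor (n : ℕ) :
    LinearMap.range (Cochain.toTensor : Cochain M ε 𝒮 n →ₗ[k] TensorCochain k S M n) =
      altTensorCochain M ε 𝒮 n := by
  ext f
  constructor
  · rintro ⟨g, rfl⟩ p q v a b h hp hq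
    have hz : wedge ε 𝒮 n v + ε a b • wedge ε 𝒮 n (v ∘ Equiv.swap p q) = 0 :=
      (Submodule.Quotient.mk_eq_zero _).2 (Submodule.subset_span ⟨p, q, v, a, b, h, hp, hq, rfl⟩)
    exact (congrArg (TensorProduct.curry g) hz).trans (map_zero _) ▸ by
      simp [toTensor, Units.smul_def]
  · intro hf
    have hle : extRelations ε 𝒮 n ≤ LinearMap.ker (PiTensorProduct.lift f) := by
      refine Submodule.span_le.2 ?_
      rintro z ⟨p, q, v, a, b, h, hp, hq, rfl⟩
      simpa [Units.smul_def] using hf p q v a b h hp hq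
    refine ⟨TensorProduct.lift ((extRelations ε 𝒮 n).liftQ _ hle), ?_⟩
    ext v y
    simp [toTensor_apply, wedge]

variable (ε 𝒮 M) in
/-- `Hom(⋀^n S ⊗ S, M)` is the space of alternating tensor cochains. -/
def cochainEquiv (n : ℕ) : Cochain M ε 𝒮 n ≃ₗ[k] altTensorCochain M ε 𝒮 n :=
  (LinearEquiv.ofInjective _ Cochain.toTensor_injective).trans
    (LinearEquiv.ofEq _ _ (Cochain.range_toTensor n))

theorem toTensor_cochainEquiv_symm {n : ℕ} (f : altTensorCochain M ε 𝒮 n) :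
    ((cochainEquiv M ε 𝒮 n).symm f).toTensor = f := by
  obtain ⟨g, rfl⟩ := (cochainEquiv M ε 𝒮 n).surjective f
  rw [LinearEquiv.symm_apply_apply]
  rfl

/-! ### The space `C^0(S, M)` is graded -/

theorem coe_decompose_apply_of_homogeneous (φ : M →ₗ[k] M) (δ : Γ)
    (hφ : ∀ (γ : Γ) (m : M), m ∈ ℳ γ → φ m ∈ ℳ (δ + γ)) (γ : Γ) (m : M) :
    (DirectSum.decompose ℳ (φ m) (δ + γ) : M) = φ (DirectSum.decompose ℳ m γ) := by
  induction m using DirectSum.Decomposition.inductionOn ℳ with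
  | zero => simp
  | add x y hx hy => simp [DirectSum.decompose_add, hx, hy]
  | @homogeneous μ m =>
    by_cases h : μ = γ
    · subst h
      rw [DirectSum.decompose_of_mem_same _ (hφ _ _ m.2), DirectSum.decompose_of_mem_same _ m.2]
    · rw [DirectSum.decompose_of_mem_ne _ (hφ _ _ m.2) (by simpa using h),
        DirectSum.decompose_of_mem_ne _ m.2 h, map_zero]

namespace GenLeftSymmBimodule

variable {A : GenLeftSymmAlgebra ε 𝒮} (B : GenLeftSymmBimodule A ℳ)

/-- For homogeneous a, b the map m ↦ (ab)m - a(bm) is homogeneous, so its kernel contains the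
components of its elements. Hence C⁰ is spanned by homogeneous elements, which makes d on C⁰ unique.
-/
theorem decompose_mem_cochainZero {m : M} (hm : m ∈ B.cochainZero) (γ : Γ) :
    (DirectSum.decompose ℳ m γ : M) ∈ B.cochainZero := by
  suffices h : A.mul.compr₂ (B.left.flip (DirectSum.decompose ℳ m γ)) =
      B.left.compl₂ (B.left.flip (DirectSum.decompose ℳ m γ)) from
    fun a b => LinearMap.congr_fun₂ h a b
  refine LinearMap.ext_homogeneous 𝒮 fun a x hx => LinearMap.ext_homogeneous 𝒮 fun b y hy => ?_
  have h := coe_decompose_apply_of_homogeneous (ℳ := ℳ)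
    (B.left (A.mul x y) - B.left x ∘ₗ B.left y) (a + b) (fun γ m hm => by
      refine (ℳ _).sub_mem (B.left_mem (A.mul_mem hx hy) hm) ?_
      rw [add_assoc]
      exact B.left_mem hx (B.left_mem hy hm)) γ m
  rw [LinearMap.sub_apply, LinearMap.comp_apply, hm x y, sub_self, DirectSum.decompose_zero] at h
  exact sub_eq_zero.1 h.symm

theorem cochainZero_ext {N : Type*} [AddCommGroup N] [Module k N]
    {φ ψ : B.cochainZero →ₗ[k] N}
    (h : ∀ (β : Γ) (m : B.cochainZero), (m : M) ∈ ℳ β → φ m = ψ m) : φ = ψ := by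
  classical
  ext m
  have hm : m = ∑ γ ∈ (DirectSum.decompose ℳ (m : M)).support,
      (⟨DirectSum.decompose ℳ (m : M) γ, B.decompose_mem_cochainZero m.2 γ⟩ : B.cochainZero) := by
    ext
    rw [Submodule.coe_sum]
    exact (DirectSum.sum_support_decompose ℳ (m : M)).symm
  rw [hm, map_sum, map_sum]
  exact Finset.sum_congr rfl fun γ _ => h γ _ (DirectSum.decompose ℳ (m : M) γ).2

/-! ### The coboundary operators -/

/-- The map `m ↦ (x ↦ ε(β, α) x·m - m·x)` for `m ∈ M_β` and `x ∈ S_α`. -/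
def innerDerivation : M →ₗ[k] S →ₗ[k] M :=
  ((DirectSum.toModule k Γ (M →ₗ[k] M) fun α =>
    LinearMap.lcomp k M (degreeScale ε ℳ α) ∘ₗ B.left ∘ₗ (𝒮 α).subtype) ∘ₗ
      (DirectSum.decomposeLinearEquiv 𝒮).toLinearMap).flip - B.right

theorem innerDerivation_apply {α β : Γ} {m : M} {x : S} (hm : m ∈ ℳ β) (hx : x ∈ 𝒮 α) :
    B.innerDerivation m x = ε β α • B.left x m - B.right m x := by
  lift x to 𝒮 α using hx
  simp [innerDerivation, DirectSum.decomposeLinearEquiv, ← DirectSum.lof_eq_of k,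
    degreeScale_of_mem _ hm, Units.smul_def]

theorem isCoboundaryZero_unique {d₀ d₀' : B.cochainZero →ₗ[k] Cochain M ε 𝒮 0}
    (h : B.IsCoboundaryZero d₀) (h' : B.IsCoboundaryZero d₀') : d₀ = d₀' := by
  refine B.cochainZero_ext fun β m hm => Cochain.toTensor_injective ?_
  ext1 v
  refine LinearMap.ext_homogeneous 𝒮 fun a x hx => ?_
  rw [Subsingleton.elim v Fin.elim0, h a β m x hm hx, h' a β m x hm hx]

theorem isCoboundarySucc_unique {d d' : ∀ n, Cochain M ε 𝒮 n →ₗ[k] Cochain M ε 𝒮 (n + 1)}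
    (h : B.IsCoboundarySucc d) (h' : B.IsCoboundarySucc d') : d = d' :=
  funext fun n => LinearMap.ext fun f => Cochain.toTensor_injective ((h n f).trans (h' n f).symm)

/-- The formula makes sense on all of M, and alternation is vacuous here; the condition defining C⁰
is needed only for d² = 0. -/
theorem exists_isCoboundaryZero :
    ∃ d₀ : B.cochainZero →ₗ[k] Cochain M ε 𝒮 0, B.IsCoboundaryZero d₀ := by
  refine ⟨(cochainEquiv M ε 𝒮 0).symm.toLinearMap ∘ₗ
    (((MultilinearMap.constLinearEquivOfIsEmpty (R := k) (S := k) (M₁ := fun _ : Fin 0 => S)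
      (M₂ := S →ₗ[k] M)).toLinearMap ∘ₗ
        B.innerDerivation ∘ₗ B.cochainZero.subtype).codRestrict _
        fun _ => mem_altTensorCochain_of_le_one (by simp) _), ?_⟩
  intro α β m x hm hx
  rw [LinearMap.comp_apply, LinearEquiv.coe_coe, toTensor_cochainEquiv_symm]
  exact B.innerDerivation_apply hm hx

theorem exists_isCoboundarySucc :
    ∃ d : ∀ n, Cochain M ε 𝒮 n →ₗ[k] Cochain M ε 𝒮 (n + 1), B.IsCoboundarySucc d := by
  refine ⟨fun n => (cochainEquiv M ε 𝒮 (n + 1)).symm.toLinearMap ∘ₗ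
    (B.tensorDiff n ∘ₗ Cochain.toTensor).codRestrict _ fun f => B.tensorDiff_mem_alt ?_, ?_⟩
  · rw [← Cochain.range_toTensor]
    exact LinearMap.mem_range_self _ f
  · intro n f
    rw [LinearMap.comp_apply, LinearEquiv.coe_coe, toTensor_cochainEquiv_symm]
    rfl

variable {B}

theorem IsCoboundaryZero.mem {d₀ : B.cochainZero →ₗ[k] Cochain M ε 𝒮 0}
    (h₀ : B.IsCoboundaryZero d₀) {β : Γ} {m : B.cochainZero} (hm : (m : M) ∈ ℳ β) :
    d₀ m ∈ homogeneousCochain ε 𝒮 ℳ 0 β := by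
  intro α δ v y _ hy
  rw [Subsingleton.elim v Fin.elim0, h₀ δ β m y hm hy]
  simp only [Finset.univ_eq_empty, Finset.sum_empty, add_zero]
  exact (ℳ _).sub_mem ((ℳ _).smul_mem (ε β δ : k) (add_comm δ β ▸ B.left_mem hy hm))
    (B.right_mem hm hy)

/-- At (x; y) the result is a multiple of x(ym) - (xy)m, zero by the definition of C⁰, plus ε(β,
a)((xm)y - x(my)) - (mx)y + m(xy), zero by the mixed axiom. -/
theorem IsCoboundarySucc.comp_coboundaryZero {d₀ : B.cochainZero →ₗ[k] Cochain M ε 𝒮 0}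
    {d : ∀ n, Cochain M ε 𝒮 n →ₗ[k] Cochain M ε 𝒮 (n + 1)}
    (h : B.IsCoboundarySucc d) (h₀ : B.IsCoboundaryZero d₀) : d 0 ∘ₗ d₀ = 0 := by
  refine B.cochainZero_ext fun β m hm => Cochain.toTensor_injective ?_
  rw [LinearMap.comp_apply, h, LinearMap.zero_apply, map_zero]
  refine ext_evalHead_of_mem 𝒮 fun a x hx => ?_
  ext1 v
  refine LinearMap.ext_homogeneous 𝒮 fun b y hy => ?_
  have hh := h₀.mem hm Fin.elim0 b Fin.elim0 y (fun s => s.elim0) hy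
  simp only [Finset.univ_eq_empty, Finset.sum_empty, add_zero] at hh
  rw [evalHead_tensorDiff_zero, B.lieAct_zero_apply _ hx, B.act_apply _ hy,
    Subsingleton.elim v Fin.elim0, degreeScale_of_mem _ hh, h₀ _ _ _ _ hm hx, h₀ _ _ _ _ hm hy,
    h₀ _ _ _ _ hm (A.mul_mem hx hy)]
  have g₁ := m.2 x y
  have g₂ := B.left_right y hx hm
  have e : (ε β a : k) * ε a β = 1 := by
    rw [← Units.val_mul, ε.val_mul_val_swap, Units.val_one]
  have e' : (ε a b : k) * ε b a = 1 := by
    rw [← Units.val_mul, ε.val_mul_val_swap, Units.val_one]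
  simp only [Units.smul_def, map_sub, map_smul, LinearMap.sub_apply, LinearMap.smul_apply,
    ε.val_add_left, ε.val_add_right, Units.val_mul, map_zero, LinearMap.zero_apply,
    zero_apply] at *
  linear_combination (norm := module) (-((ε β a : k) * ε β b)) • g₁ + (ε β a : k) • g₂ +
    e • (B.right (B.right m x) y - B.right m (A.mul x y)) +
    e' • (((ε β a : k) * ε β b) • B.left x (B.left y m) - (ε β a : k) • B.left x (B.right m y))

end GenLeftSymmBimodule

end

end

/-! ### The pre-simplicial identities and the cochain complex -/

theorem proposition3p1 {Γ : Type uΓ} {k : Type uk} {S : Type uS} {M : Type uM}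
    [AddCommGroup Γ] [DecidableEq Γ] [Field k] [CharZero k]
    [AddCommGroup S] [Module k S] [FiniteDimensional k S]
    [AddCommGroup M] [Module k M] [FiniteDimensional k M]
    (ε : CommutationFactor Γ k)
    (𝒮 : Γ → Submodule k S) [DirectSum.Decomposition 𝒮]
    (ℳ : Γ → Submodule k M) [DirectSum.Decomposition ℳ]
    (A : GenLeftSymmAlgebra ε 𝒮) (B : GenLeftSymmBimodule A ℳ) :
    -- the formula for `D_t` on homogeneous cochains and arguments, for `t ≤ i = n + 1`
    (∀ (n : ℕ) (t : Fin (n + 1)) (β : Γ) (f : TensorCochain k S M n)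
      (α : Fin (n + 1) → Γ) (v : Fin (n + 1) → S) (y : S),
      f ∈ homogeneousTensorCochain 𝒮 ℳ n β → (∀ s, v s ∈ 𝒮 (α s)) →
      B.D (t + 1) n f v y =
        ε (β + ∑ s ∈ Finset.Iio t, α s) (α t) • B.left (v t) (f (t.removeNth v) y)
        - ε (α t) (∑ s ∈ Finset.Ioi t, α s) • f (t.removeNth v) (A.mul (v t) y)
        + ε (α t) (∑ s ∈ Finset.Ioi t, α s) • B.right (f (t.removeNth v) (v t)) y
        - ∑ j ∈ Finset.Ioi t, ε (α t) (∑ s ∈ Finset.Ioo t j, α s) •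
            f (t.removeNth (Function.update v j
              (A.mul (v t) (v j) - ε (α t) (α j) • A.mul (v j) (v t)))) y) ∧
    -- `D_t = 0` on `C^i` for `t > i`
    (∀ t n : ℕ, n + 1 < t → B.D t n = 0) ∧
    -- `D_t` is homogeneous of degree zero
    (∀ (t n : ℕ) (β : Γ) (f : TensorCochain k S M n),
      f ∈ homogeneousTensorCochain 𝒮 ℳ n β →
      B.D t n f ∈ homogeneousTensorCochain 𝒮 ℳ (n + 1) β) ∧
    -- the pre-simplicial identities
    (∀ s t n : ℕ, 1 ≤ s → s < t →
      B.D t (n + 1) ∘ₗ B.D s n = B.D s (n + 1) ∘ₗ B.D (t - 1) n) ∧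
    -- `d² = 0` for `d = -∑ (-1)^t D_t`
    (∀ n : ℕ, B.tensorDiff (n + 1) ∘ₗ B.tensorDiff n = 0) ∧
    -- the coboundary operators of the complex `C^0 → C^1 → C^2 → ⋯` exist and are unique
    (∃! d₀ : B.cochainZero →ₗ[k] Cochain M ε 𝒮 0, B.IsCoboundaryZero d₀) ∧
    (∃! d : ∀ n, Cochain M ε 𝒮 n →ₗ[k] Cochain M ε 𝒮 (n + 1), B.IsCoboundarySucc d) ∧
    -- they are homogeneous of degree zero and square to zero, so that coboundaries are cocycles
    (∀ (d₀ : B.cochainZero →ₗ[k] Cochain M ε 𝒮 0)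
      (d : ∀ n, Cochain M ε 𝒮 n →ₗ[k] Cochain M ε 𝒮 (n + 1)),
      B.IsCoboundaryZero d₀ → B.IsCoboundarySucc d →
      (∀ (β : Γ) (m : B.cochainZero), (m : M) ∈ ℳ β → d₀ m ∈ homogeneousCochain ε 𝒮 ℳ 0 β) ∧
      (∀ (n : ℕ) (β : Γ) (f : Cochain M ε 𝒮 n), f ∈ homogeneousCochain ε 𝒮 ℳ n β →
        d n f ∈ homogeneousCochain ε 𝒮 ℳ (n + 1) β) ∧
      d 0 ∘ₗ d₀ = 0 ∧
      (∀ n : ℕ, d (n + 1) ∘ₗ d n = 0) ∧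
      LinearMap.range d₀ ≤ LinearMap.ker (d 0) ∧
      (∀ n : ℕ, LinearMap.range (d n) ≤ LinearMap.ker (d (n + 1)))) := by
  have hDD (s t n : ℕ) (hs : 1 ≤ s) (hst : s < t) :
      B.D t (n + 1) ∘ₗ B.D s n = B.D s (n + 1) ∘ₗ B.D (t - 1) n := by
    obtain ⟨s, rfl⟩ := Nat.exists_eq_add_of_le' hs
    obtain ⟨t, rfl⟩ : ∃ r, t = r + 1 := ⟨t - 1, by omega⟩
    exact LinearMap.ext fun f => B.D_D s t n (by omega) f
  refine ⟨fun n t β f α v y hf hv => B.D_apply t y hf hv, fun t n h => B.D_of_lt h,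
    fun t n β f hf => B.D_mem t n hf, hDD, fun n => LinearMap.ext (B.tensorDiff_tensorDiff n),
    existsUnique_of_exists_of_unique B.exists_isCoboundaryZero
      fun _ _ => B.isCoboundaryZero_unique,
    existsUnique_of_exists_of_unique B.exists_isCoboundarySucc
      fun _ _ => B.isCoboundarySucc_unique, fun d₀ d h₀ h => ?_⟩
  have hd₀ : d 0 ∘ₗ d₀ = 0 := h.comp_coboundaryZero h₀
  have hd (n : ℕ) : d (n + 1) ∘ₗ d n = 0 := by
    -- The complex embeds in the tensor cochains, where d² = 0 is already known.
    refine LinearMap.ext fun f => Cochain.toTensor_injective ?_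
    rw [LinearMap.comp_apply, h, h, B.tensorDiff_tensorDiff, LinearMap.zero_apply, map_zero]
  refine ⟨fun β m hm => h₀.mem hm, fun n β f hf => ?_, hd₀, hd,
    LinearMap.range_le_ker_iff.2 hd₀, fun n => LinearMap.range_le_ker_iff.2 (hd n)⟩
  rw [homogeneousCochain, Submodule.mem_comap, h]
  exact B.tensorDiff_mem n hf
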